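/- Let $f:[0,\infty)\to[0,\infty)$ be a nondecreasing $C^1$ function (one-sided at $0$) with $f(0)=0$. Then there is no bounded continuous function $u:[0,\infty)\to\mathbb{R}$ such that $$A_{1/2}u=f(u)\ \text{ in }(0,\infty),\qquad u>0\ \text{ in }(0,\infty),\qquad u(0)=0 .$$ Here $A_{1/2}$ is the square root of the Laplacian $-d^2/dx^2$ in $(0,\infty)$ with zero Dirichlet boundary condition at $x=0$, defined as follows. For a bounded continuous $u:[0,\infty)\to\mathbb{R}$ with $u(0)=0$, let $v$ be its bounded harmonic extension, that is, the bounded continuous function on $[0,\infty)\times[0,\infty)$ that is harmonic in $(0,\infty)\times(0,\infty)$ and satisfies $v(0,y)=0$ for all $y\ge 0$ and $v(x,0)=u(x)$ for all $x\ge 0$. Then $A_{1/2}u=g$ in $(0,\infty)$ means that for every $x>0$ the one-sided derivative $\partial_y v(x,0)=\lim_{y\to0^+}\frac{v(x,y)-v(x,0)}{y}$ exists and $-\partial_y v(x,0)=g(x)$. -/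

import Mathlib

open Set

/-- The open quarter plane `{(x, y) : x > 0, y > 0}`, with the plane identified with `ℂ`. -/
def quarterPlane : Set ℂ := {z | 0 < z.re ∧ 0 < z.im}

/-- The closed quarter plane `{(x, y) : x ≥ 0, y ≥ 0}`. -/
def closedQuarterPlane : Set ℂ := {z | 0 ≤ z.re ∧ 0 ≤ z.im}

/-- `v` is the bounded harmonic extension of `u : [0, ∞) → ℝ` to the half-cylinder
`(0, ∞) × (0, ∞)` with zero Dirichlet condition on the lateral boundary `{x = 0}`.
Only the values of `u` on `[0, ∞)` and of `v` on the closed quarter plane matter.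
Boundedness is what makes the extension unique: `x * y` is a nonzero harmonic function that
vanishes on the two sides of the quarter plane. -/
structure IsDirichletHarmonicExtension (u : ℝ → ℝ) (v : ℂ → ℝ) : Prop where
  harmonic : InnerProductSpace.HarmonicOnNhd v quarterPlane
  continuousOn : ContinuousOn v closedQuarterPlane
  bounded : ∃ M : ℝ, ∀ z ∈ closedQuarterPlane, |v z| ≤ M
  lateral : ∀ y : ℝ, 0 ≤ y → v ⟨0, y⟩ = 0
  trace : ∀ x : ℝ, 0 ≤ x → v ⟨x, 0⟩ = u x

/-- `A_{1/2} u = g` on `(0, ∞)`, where `A_{1/2}` is the square root of the Laplacian `-d²/dx²` in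
`(0, ∞)` with zero Dirichlet condition at `0`, acting on bounded functions: `g` is the outer normal
derivative `-∂v/∂y (x, 0)` of the harmonic extension `v` of `u`, for every `x > 0`. -/
def HasDirichletSqrtLaplacian (u g : ℝ → ℝ) : Prop :=
  ∃ v : ℂ → ℝ, IsDirichletHarmonicExtension u v ∧
    ∀ x : ℝ, 0 < x → HasDerivWithinAt (fun y : ℝ => v ⟨x, y⟩) (-(g x)) (Ici 0) 0

/-! The extension `v` is nonnegative by Phragmén–Lindelöf (`nonneg_of_quarterPlane`). Moving planes
(`le_reflection`) compare `v` with its reflection in each line `re z = l`. In the half-strip their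
difference satisfies a Robin inequality of bad sign. `nonneg_of_halfStrip` handles it near the
mirror, and the Hopf lemma `deriv_pos_of_rectangle` excludes a first contact. Hence `u` is
nondecreasing.

Then `f ∘ u` is nondecreasing too. If `f (u a) > 0`, the flux is bounded below on `[a, ∞)`, and
`le_of_rectangle_of_deriv_le` makes `u` grow linearly, against boundedness. So `f ∘ u` vanishes, `v`
has zero Neumann data on the bottom and zero lateral data, and Phragmén–Lindelöf applied to `-v`
gives `u ≤ 0`. -/

section

open InnerProductSpace Filter Topology
open scoped Complex

/-! ### Minimum and comparison principles on bounded sets -/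

/-- The minimum principle: a harmonic function with a local minimum is locally constant there. -/
lemma InnerProductSpace.HarmonicAt.eventually_eq_of_isLocalMin {g : ℂ → ℝ} {z : ℂ}
    (hg : HarmonicAt g z) (hmin : IsLocalMin g z) : ∀ᶠ ζ in 𝓝 z, g ζ = g z := by
  obtain ⟨r, hr, hball⟩ := Metric.eventually_nhds_iff_ball.1 hg.eventually
  obtain ⟨F, hF, hre⟩ := HarmonicOnNhd.exists_analyticOnNhd_ball_re_eq
    (f := g) (z := z) (R := r) (fun ζ hζ => hball ζ hζ)
  have hnhds : Metric.ball z r ∈ 𝓝 z := Metric.ball_mem_nhds z hr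
  -- A minimum of `g = re F` is a maximum of `|exp (-F)|`, so the maximum modulus principle applies.
  have hnorm : ∀ ζ ∈ Metric.ball z r, ‖Complex.exp (-F ζ)‖ = Real.exp (-g ζ) := by
    intro ζ hζ
    rw [Complex.norm_exp, Complex.neg_re, ← hre hζ]
  have hz := hnorm z (Metric.mem_ball_self hr)
  have hd : ∀ᶠ ζ in 𝓝 z, DifferentiableAt ℂ (fun ζ => Complex.exp (-F ζ)) ζ := by
    filter_upwards [hnhds] with ζ hζ
    exact (hF ζ hζ).differentiableAt.neg.cexp
  have hmax : IsLocalMax (norm ∘ fun ζ => Complex.exp (-F ζ)) z := by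
    filter_upwards [hnhds, hmin] with ζ hζ hle
    simp only [Function.comp_apply]
    rw [hnorm ζ hζ, hz]
    exact Real.exp_le_exp.2 (neg_le_neg hle)
  filter_upwards [hnhds, Complex.norm_eventually_eq_of_isLocalMax hd hmax] with ζ hζ heq
  rw [hnorm ζ hζ, hz] at heq
  exact neg_injective (Real.exp_injective heq)

/-- A function that is harmonic in a bounded open set and continuous on its closure attains its
minimum on the frontier. -/
lemma InnerProductSpace.HarmonicOnNhd.exists_mem_frontier_isMinOn {g : ℂ → ℝ} {D : Set ℂ}
    (hD : IsOpen D) (hb : Bornology.IsBounded D) (hne : D.Nonempty)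
    (hg : HarmonicOnNhd g D) (hc : ContinuousOn g (closure D)) :
    ∃ z ∈ frontier D, IsMinOn g (closure D) z := by
  have hK : IsCompact (closure D) := hb.isCompact_closure
  obtain ⟨z₀, hz₀, hmin⟩ := hK.exists_isMinOn hne.closure hc
  have hS : IsCompact (closure D ∩ g ⁻¹' {g z₀}) :=
    hK.of_isClosed_subset (hc.preimage_isClosed_of_isClosed isClosed_closure isClosed_singleton)
      inter_subset_left
  -- A lowest minimum point cannot be interior: local constancy would give a lower one.
  obtain ⟨z, ⟨hz, hgz⟩, hlow⟩ := hS.exists_isMinOn ⟨z₀, hz₀, rfl⟩ Complex.continuous_im.continuousOn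
  have hgz : g z = g z₀ := hgz
  have hminz : IsMinOn g (closure D) z := fun ζ hζ => by
    have : g z₀ ≤ g ζ := hmin hζ
    simpa [hgz] using this
  refine ⟨z, ?_, hminz⟩
  rw [hD.frontier_eq]
  refine ⟨hz, fun hzD => ?_⟩
  have hnhds : D ∈ 𝓝 z := hD.mem_nhds hzD
  have hconst := (hg z hzD).eventually_eq_of_isLocalMin
    ((hminz.isLocalMin (mem_of_superset hnhds subset_closure)))
  obtain ⟨r, hr, hball⟩ := Metric.eventually_nhds_iff_ball.1 (hconst.and hnhds)
  have hmem : z - (r / 2 : ℝ) * Complex.I ∈ Metric.ball z r := by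
    rw [Metric.mem_ball, dist_eq_norm]
    simp only [sub_sub_cancel_left, norm_neg, norm_mul, Complex.norm_real, Complex.norm_I, mul_one,
      Real.norm_eq_abs, abs_of_pos (half_pos hr)]
    linarith
  obtain ⟨h1, h2⟩ := hball _ hmem
  have : z.im ≤ (z - (r / 2 : ℝ) * Complex.I).im :=
    hlow ⟨subset_closure h2, by simpa [hgz] using h1⟩
  simp at this
  linarith

lemma HasDerivWithinAt.nonneg_of_forall_le {g : ℝ → ℝ} {d c : ℝ}
    (hg : HasDerivWithinAt g d (Ici 0) 0) (hc : 0 < c) (hle : ∀ y ∈ Icc 0 c, g 0 ≤ g y) :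
    0 ≤ d := by
  have h := (hasDerivWithinAt_iff_tendsto_slope' (by simp)).1 (hg.Ioi_of_Ici)
  refine ge_of_tendsto h ?_
  filter_upwards [Ioo_mem_nhdsGT hc] with y hy
  rw [slope_def_field]
  exact div_nonneg (sub_nonneg.2 (hle y ⟨hy.1.le, hy.2.le⟩)) (by linarith [hy.1])

/-- Comparison in a rectangle of a harmonic function `w` with a positive harmonic function `ψ`.
On the bottom, a lower bound may be replaced by an inequality between normal derivatives. -/
lemma neg_mul_le_of_rectangle {w ψ : ℂ → ℝ} {a b c κ : ℝ} (hab : a < b) (hc : 0 < c) (hκ : 0 ≤ κ)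
    (hw : HarmonicOnNhd w (Ioo a b ×ℂ Ioo 0 c)) (hwc : ContinuousOn w (Icc a b ×ℂ Icc 0 c))
    (hψ : HarmonicOnNhd ψ (Ioo a b ×ℂ Ioo 0 c)) (hψc : ContinuousOn ψ (Icc a b ×ℂ Icc 0 c))
    (hpos : ∀ z ∈ Icc a b ×ℂ Icc 0 c, 0 < ψ z)
    (hleft : ∀ y ∈ Icc 0 c, -κ * ψ ⟨a, y⟩ ≤ w ⟨a, y⟩)
    (hright : ∀ y ∈ Icc 0 c, -κ * ψ ⟨b, y⟩ ≤ w ⟨b, y⟩)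
    (htop : ∀ x ∈ Icc a b, -κ * ψ ⟨x, c⟩ ≤ w ⟨x, c⟩)
    (hbot : ∀ x ∈ Ioo a b, w ⟨x, 0⟩ < 0 → ∃ d d' : ℝ,
      HasDerivWithinAt (fun y : ℝ => w ⟨x, y⟩) d (Ici 0) 0 ∧
      HasDerivWithinAt (fun y : ℝ => ψ ⟨x, y⟩) d' (Ici 0) 0 ∧ d * ψ ⟨x, 0⟩ < w ⟨x, 0⟩ * d') :
    ∀ z ∈ Icc a b ×ℂ Icc 0 c, -κ * ψ z ≤ w z := by
  have hcl : closure (Ioo a b ×ℂ Ioo 0 c) = Icc a b ×ℂ Icc 0 c := by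
    rw [Complex.closure_reProdIm, closure_Ioo hab.ne, closure_Ioo hc.ne]
  have hopen : IsOpen (Ioo a b ×ℂ Ioo 0 c) := isOpen_Ioo.reProdIm isOpen_Ioo
  have hbdd : Bornology.IsBounded (Ioo a b ×ℂ Ioo 0 c) :=
    (Metric.isBounded_Ioo a b).reProdIm (Metric.isBounded_Ioo 0 c)
  have hne : (Ioo a b ×ℂ Ioo 0 c).Nonempty :=
    ⟨⟨(a + b) / 2, c / 2⟩, by
      rw [Complex.mem_reProdIm]; constructor <;> constructor <;> dsimp only <;> linarith⟩
  have hK : IsCompact (Icc a b ×ℂ Icc 0 c) := by rw [← hcl]; exact hbdd.isCompact_closure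
  obtain ⟨z₀, hz₀, hmin⟩ := hK.exists_isMinOn (by rw [← hcl]; exact hne.closure)
    (hwc.div hψc fun z hz => (hpos z hz).ne')
  -- With `r = min (w / ψ)`, the function `w - r ψ` is nonnegative and touches zero. If `r < -κ`, a
  -- contact point on the frontier can only lie on the open bottom side.
  set r := w z₀ / ψ z₀ with hr
  have hle : ∀ z ∈ Icc a b ×ℂ Icc 0 c, r * ψ z ≤ w z := fun z hz =>
    (le_div_iff₀ (hpos z hz)).1 (hmin hz)
  have heq : w z₀ = r * ψ z₀ := by rw [hr, div_mul_cancel₀ _ (hpos z₀ hz₀).ne']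
  by_contra! hcon
  obtain ⟨z₁, hz₁, hlt⟩ := hcon
  have hrκ : r < -κ := by
    have := (hle z₁ hz₁).trans_lt hlt
    exact lt_of_mul_lt_mul_right this (hpos z₁ hz₁).le
  obtain ⟨z, hz, hzmin⟩ := HarmonicOnNhd.exists_mem_frontier_isMinOn hopen hbdd hne
    (g := w - r • ψ) (hw.sub hψ.const_smul)
    (by rw [hcl]; exact hwc.sub (hψc.const_smul r))
  rw [hcl] at hzmin
  have hzK : z ∈ Icc a b ×ℂ Icc 0 c := by rw [← hcl]; exact frontier_subset_closure hz
  have hzeq : w z = r * ψ z := by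
    refine le_antisymm ?_ (hle z hzK)
    have : (w - r • ψ) z ≤ (w - r • ψ) z₀ := hzmin hz₀
    simp only [Pi.sub_apply, Pi.smul_apply, smul_eq_mul] at this
    linarith
  have hzlt : w z < -κ * ψ z := by
    rw [hzeq]
    exact mul_lt_mul_of_pos_right hrκ (hpos z hzK)
  rw [hopen.frontier_eq, hcl, Set.mem_sdiff, Complex.mem_reProdIm, Complex.mem_reProdIm] at hz
  obtain ⟨⟨hx, hy⟩, hnot⟩ := hz
  obtain ⟨x, y⟩ := z
  dsimp only at hx hy hnot
  rcases eq_or_lt_of_le hx.1 with rfl | hx1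
  · exact absurd (hleft y hy) hzlt.not_ge
  rcases eq_or_lt_of_le hx.2 with rfl | hx2
  · exact absurd (hright y hy) hzlt.not_ge
  rcases eq_or_lt_of_le hy.2 with rfl | hy2
  · exact absurd (htop x hx) hzlt.not_ge
  rcases eq_or_lt_of_le hy.1 with rfl | hy1
  swap
  · exact hnot ⟨⟨hx1, hx2⟩, hy1, hy2⟩
  have hψ0 := hpos _ hzK
  have hr0 : r < 0 := hrκ.trans_le (neg_nonpos.2 hκ)
  obtain ⟨d, d', hd, hd', hdd⟩ := hbot x ⟨hx1, hx2⟩ (by rw [hzeq]; exact mul_neg_of_neg_of_pos hr0 hψ0)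
  have hderiv := (hd.sub (hd'.const_mul r)).nonneg_of_forall_le hc (fun y hy => by
    have := hle ⟨x, y⟩ ⟨hx, hy⟩
    simp only [Pi.sub_apply]
    rw [hzeq, sub_self]
    linarith)
  rw [hzeq] at hdd
  nlinarith

/-! ### Logarithmic potentials and reflections -/

lemma hasDerivAt_log_norm_sub {x y₀ : ℝ} {p : ℂ} (hne : (⟨x, y₀⟩ : ℂ) ≠ p) :
    HasDerivAt (fun y : ℝ => Real.log ‖(⟨x, y⟩ : ℂ) - p‖)
      ((y₀ - p.im) / ((x - p.re) ^ 2 + (y₀ - p.im) ^ 2)) y₀ := by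
  have hfun : (fun y : ℝ => Real.log ‖(⟨x, y⟩ : ℂ) - p‖)
      = fun y : ℝ => Real.log ((x - p.re) ^ 2 + (y - p.im) ^ 2) / 2 := by
    funext y
    rw [Complex.norm_def, Real.log_sqrt (Complex.normSq_nonneg _), Complex.normSq_apply]
    simp only [Complex.sub_re, Complex.sub_im, pow_two]
  have hpos : (x - p.re) ^ 2 + (y₀ - p.im) ^ 2 ≠ 0 := by
    intro h
    apply hne
    have h1 : (x - p.re) ^ 2 = 0 := by nlinarith [sq_nonneg (x - p.re), sq_nonneg (y₀ - p.im)]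
    have h2 : (y₀ - p.im) ^ 2 = 0 := by nlinarith [sq_nonneg (x - p.re), sq_nonneg (y₀ - p.im)]
    apply Complex.ext
    · simpa [sub_eq_zero] using h1
    · simpa [sub_eq_zero] using h2
  rw [hfun]
  have h1 : HasDerivAt (fun y : ℝ => (x - p.re) ^ 2 + (y - p.im) ^ 2) (2 * (y₀ - p.im)) y₀ := by
    simpa using (((hasDerivAt_id y₀).sub_const p.im).pow 2).const_add ((x - p.re) ^ 2)
  exact ((h1.log hpos).div_const 2).congr_deriv (by ring)

lemma harmonicAt_log_norm_sub {z p : ℂ} (hne : z ≠ p) :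
    HarmonicAt (fun z => Real.log ‖z - p‖) z :=
  AnalyticAt.harmonicAt_log_norm (f := fun z => z - p) (by fun_prop) (sub_ne_zero.2 hne)

lemma continuousOn_log_norm_sub {p : ℂ} {s : Set ℂ} (hs : p ∉ s) :
    ContinuousOn (fun z => Real.log ‖z - p‖) s :=
  ContinuousOn.log (by fun_prop) fun z hz =>
    norm_ne_zero_iff.2 (sub_ne_zero.2 fun h => hs (h ▸ hz))

/-- Harmonicity is preserved by reflection in a vertical line. -/
lemma InnerProductSpace.HarmonicAt.comp_reflection {v : ℂ → ℝ} {z : ℂ} (a : ℝ)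
    (hv : HarmonicAt v (a - (starRingEnd ℂ) z)) :
    HarmonicAt (fun ζ => v (a - (starRingEnd ℂ) ζ)) z := by
  obtain ⟨r, hr, hball⟩ := Metric.eventually_nhds_iff_ball.1 hv.eventually
  obtain ⟨F, hF, hre⟩ := HarmonicOnNhd.exists_analyticOnNhd_ball_re_eq
    (f := v) (R := r) (fun ζ hζ => hball ζ hζ)
  have hmaps : ∀ ζ ∈ Metric.ball z r,
      a - (starRingEnd ℂ) ζ ∈ Metric.ball (a - (starRingEnd ℂ) z) r := by
    intro ζ hζ
    rw [Metric.mem_ball, dist_eq_norm] at hζ ⊢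
    rw [sub_sub_sub_cancel_left, ← map_sub, Complex.norm_conj, norm_sub_rev]
    exact hζ
  -- Conjugating twice keeps holomorphy, and the real part is the reflected function.
  have hdiff : DifferentiableOn ℂ
      (fun ζ => (starRingEnd ℂ) (F (a - (starRingEnd ℂ) ζ))) (Metric.ball z r) := by
    intro ζ hζ
    have h1 : DifferentiableAt ℂ F ((starRingEnd ℂ) (a - ζ)) := by
      have := (hF _ (hmaps ζ hζ)).differentiableAt
      simpa using this
    have h2 : DifferentiableAt ℂ ((starRingEnd ℂ) ∘ F ∘ (starRingEnd ℂ)) (a - ζ) := by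
      simpa using h1.conj_conj
    have h3 := h2.comp ζ ((differentiableAt_const (a : ℂ)).sub differentiableAt_id)
    have heq : (fun ζ => (starRingEnd ℂ) (F (a - (starRingEnd ℂ) ζ)))
        = ((starRingEnd ℂ) ∘ F ∘ (starRingEnd ℂ)) ∘ fun ζ => a - ζ := by
      funext η
      simp
    rw [heq]
    exact h3.differentiableWithinAt
  have han := hdiff.analyticAt (Metric.ball_mem_nhds z hr)
  refine (harmonicAt_congr_nhds ?_).1 han.harmonicAt_re
  filter_upwards [Metric.ball_mem_nhds z hr] with ζ hζ
  simpa using hre (hmaps ζ hζ)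

/-! ### Maximum principles in unbounded domains -/

/-- A Phragmén–Lindelöf principle in the quarter plane, with mixed boundary conditions. -/
lemma nonneg_of_quarterPlane {w : ℂ → ℝ} {M : ℝ} (hw : HarmonicOnNhd w quarterPlane)
    (hwc : ContinuousOn w closedQuarterPlane) (hM : ∀ z ∈ closedQuarterPlane, |w z| ≤ M)
    (hleft : ∀ y : ℝ, 0 ≤ y → 0 ≤ w ⟨0, y⟩)
    (hbot : ∀ x : ℝ, 0 < x → w ⟨x, 0⟩ < 0 →
      HasDerivWithinAt (fun y : ℝ => w ⟨x, y⟩) 0 (Ici 0) 0) :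
    ∀ z ∈ closedQuarterPlane, 0 ≤ w z := by
  intro z hz
  -- Real part `-2` makes the logarithm positive on the quarter plane; positive imaginary part makes
  -- its `y`-derivative negative on the bottom, giving the strict inequality needed there.
  set p : ℂ := ⟨-2, 1⟩ with hp
  set φ : ℂ → ℝ := fun z => Real.log ‖z - p‖ with hφ
  have hMnn : 0 ≤ M := (abs_nonneg _).trans (hM z hz)
  have hnorm : ∀ z ∈ closedQuarterPlane, 2 ≤ ‖z - p‖ := fun z hz => by
    refine le_trans ?_ (Complex.re_le_norm _)
    simp only [hp, Complex.sub_re]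
    linarith [hz.1]
  have hp_mem : p ∉ closedQuarterPlane := fun h => by
    have := hnorm p h
    norm_num at this
  have hne : ∀ z ∈ closedQuarterPlane, z ≠ p := fun z hz h => hp_mem (h ▸ hz)
  have hφpos : ∀ z ∈ closedQuarterPlane, 0 < φ z := fun z hz =>
    Real.log_pos (by linarith [hnorm z hz])
  have key : ∀ ρ : ℝ, 2 < ρ → z.re ≤ ρ → z.im ≤ ρ → -(M / Real.log (ρ - 1)) * φ z ≤ w z := by
    intro ρ hρ hre him
    have hsub : Icc 0 ρ ×ℂ Icc 0 ρ ⊆ closedQuarterPlane := fun ζ hζ => ⟨hζ.1.1, hζ.2.1⟩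
    have hsub' : Ioo 0 ρ ×ℂ Ioo 0 ρ ⊆ quarterPlane := fun ζ hζ => ⟨hζ.1.1, hζ.2.1⟩
    have hlog : 0 < Real.log (ρ - 1) := Real.log_pos (by linarith)
    have hκ : 0 ≤ M / Real.log (ρ - 1) := div_nonneg hMnn hlog.le
    have hfar : ∀ ζ ∈ closedQuarterPlane, ρ - 1 ≤ ‖ζ - p‖ →
        -(M / Real.log (ρ - 1)) * φ ζ ≤ w ζ := by
      intro ζ hζ hn
      have h1 : Real.log (ρ - 1) ≤ φ ζ := Real.log_le_log (by linarith) hn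
      have h2 : M ≤ M / Real.log (ρ - 1) * φ ζ := by
        calc M = M / Real.log (ρ - 1) * Real.log (ρ - 1) := (div_mul_cancel₀ _ hlog.ne').symm
          _ ≤ _ := mul_le_mul_of_nonneg_left h1 hκ
      linarith [(abs_le.1 (hM ζ hζ)).1]
    have hmem0 : ∀ x y : ℝ, 0 ≤ x → 0 ≤ y → (⟨x, y⟩ : ℂ) ∈ closedQuarterPlane :=
      fun x y hx hy => ⟨hx, hy⟩
    refine neg_mul_le_of_rectangle (by linarith) (by linarith) hκ (hw.mono hsub')
      (hwc.mono hsub) (fun ζ hζ => harmonicAt_log_norm_sub (hne ζ (hsub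
        ⟨Ioo_subset_Icc_self hζ.1, Ioo_subset_Icc_self hζ.2⟩)))
      (continuousOn_log_norm_sub fun h => hp_mem (hsub h)) (fun ζ hζ => hφpos ζ (hsub hζ))
      (fun y hy => ?_) (fun y hy => ?_) (fun x hx => ?_) (fun x hx hneg => ?_) z
      ⟨⟨hz.1, hre⟩, hz.2, him⟩
    · have := mul_nonneg hκ (hφpos _ (hmem0 0 y le_rfl hy.1)).le
      linarith [hleft y hy.1]
    · refine hfar _ (hmem0 _ _ (by linarith) hy.1) (le_trans ?_ (Complex.re_le_norm _))
      simp only [hp, Complex.sub_re]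
      linarith
    · refine hfar _ (hmem0 _ _ hx.1 (by linarith)) (le_trans ?_ (Complex.im_le_norm _))
      simp only [hp, Complex.sub_im]
      linarith
    · refine ⟨0, _, hbot x hx.1 hneg, (hasDerivAt_log_norm_sub
        (hne _ (hmem0 x 0 hx.1.le le_rfl))).hasDerivWithinAt, ?_⟩
      rw [zero_mul]
      refine mul_pos_of_neg_of_neg hneg (div_neg_of_neg_of_pos ?_ ?_)
      · simp [hp]
      · simp only [hp]
        nlinarith [sq_nonneg (x - -2)]
  have hlim : Tendsto (fun ρ : ℝ => -(M / Real.log (ρ - 1)) * φ z) atTop (𝓝 (-0 * φ z)) := by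
    refine ((Tendsto.const_div_atTop ?_ M).neg).mul_const _
    exact Real.tendsto_log_atTop.comp (tendsto_atTop_add_const_right _ (-1) tendsto_id)
  rw [neg_zero, zero_mul] at hlim
  refine le_of_tendsto hlim ?_
  filter_upwards [eventually_gt_atTop 2, eventually_ge_atTop z.re, eventually_ge_atTop z.im]
    with ρ h1 h2 h3 using key ρ h1 h2 h3

/-- A maximum principle in a vertical half-strip for a Robin condition of the unfavourable sign
that is imposed only close to one of the corners. -/
lemma nonneg_of_halfStrip {w : ℂ → ℝ} {l ε L M : ℝ} (hl : 0 < l) (hε : 0 < ε) (hε1 : ε ≤ 1)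
    (hL : 0 ≤ L) (hsmall : L * (1 + Real.log ((l + 1) / ε)) + 1 < 1 / (2 * ε))
    (hw : HarmonicOnNhd w (Ioo 0 l ×ℂ Ioi 0)) (hwc : ContinuousOn w (Icc 0 l ×ℂ Ici 0))
    (hM : ∀ z ∈ Icc 0 l ×ℂ Ici 0, |w z| ≤ M)
    (hleft : ∀ y : ℝ, 0 ≤ y → 0 ≤ w ⟨0, y⟩) (hright : ∀ y : ℝ, 0 ≤ y → 0 ≤ w ⟨l, y⟩)
    (hbot : ∀ x ∈ Ioo 0 l, w ⟨x, 0⟩ < 0 → l - ε < x ∧ ∃ d,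
      HasDerivWithinAt (fun y : ℝ => w ⟨x, y⟩) d (Ici 0) 0 ∧ d ≤ -L * w ⟨x, 0⟩) :
    ∀ z ∈ Icc 0 l ×ℂ Ici 0, 0 ≤ w z := by
  intro z hz
  have hMnn : 0 ≤ M := (abs_nonneg _).trans (hM z hz)
  set p : ℂ := ⟨l, -ε⟩ with hp
  -- The pole lies `ε` below the corner, so for `l - ε < x < l` the bottom derivative is at most `1
  -- - 1 / (2ε)`, which is below `-L ψ` by `hsmall`. The term `z.im` outgrows the logarithm and
  -- controls infinity.
  set ψ : ℂ → ℝ := fun z => z.im + (1 + Real.log (l + 1)) - Real.log ‖z - p‖ with hψ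
  have hnorm : ∀ z ∈ Icc 0 l ×ℂ Ici 0, ε ≤ ‖z - p‖ := fun z hz => by
    refine le_trans ?_ (Complex.im_le_norm _)
    simp only [hp, Complex.sub_im]
    linarith [show 0 ≤ z.im from hz.2]
  have hp_mem : p ∉ Icc 0 l ×ℂ Ici 0 := fun h => by
    have := hnorm p h
    rw [sub_self, norm_zero] at this
    linarith
  have hμ : 0 < l / (l + 1) := by positivity
  have hlow : ∀ z ∈ Icc 0 l ×ℂ Ici 0, 1 + l / (l + 1) * z.im ≤ ψ z := fun z hz => by
    have hy : 0 ≤ z.im := hz.2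
    have h1 : ‖z - p‖ ≤ l + 1 + z.im := by
      refine (Complex.norm_le_abs_re_add_abs_im _).trans ?_
      simp only [hp, Complex.sub_re, Complex.sub_im]
      rw [abs_of_nonpos (by linarith [hz.1.2]), abs_of_nonneg (by linarith)]
      linarith [hz.1.1]
    have h2 : Real.log ‖z - p‖ ≤ Real.log (l + 1 + z.im) :=
      Real.log_le_log (hε.trans_le (hnorm z hz)) h1
    have h3 : Real.log (l + 1 + z.im) = Real.log (l + 1) + Real.log (1 + z.im / (l + 1)) := by
      rw [← Real.log_mul (by positivity) (by positivity)]
      congr 1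
      field_simp
    have h4 : Real.log (1 + z.im / (l + 1)) ≤ z.im / (l + 1) := by
      have := Real.log_le_sub_one_of_pos (x := 1 + z.im / (l + 1)) (by positivity)
      linarith
    have h5 : l / (l + 1) * z.im = z.im - z.im / (l + 1) := by
      field_simp
      ring
    simp only [hψ]
    linarith
  have hψpos : ∀ z ∈ Icc 0 l ×ℂ Ici 0, 0 < ψ z := fun z hz => by
    have : 0 ≤ l / (l + 1) * z.im := mul_nonneg hμ.le hz.2
    linarith [hlow z hz]
  have hψharm : ∀ z, z ≠ p → HarmonicAt ψ z := fun z hne =>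
    (((analyticAt_id (𝕜 := ℂ) (z := z)).harmonicAt_im).add (harmonicAt_const _)).sub
      (harmonicAt_log_norm_sub hne)
  have hmem0 : ∀ x y : ℝ, x ∈ Icc 0 l → 0 ≤ y → (⟨x, y⟩ : ℂ) ∈ Icc 0 l ×ℂ Ici 0 :=
    fun x y hx hy => ⟨hx, hy⟩
  have key : ∀ Y : ℝ, 0 < Y → z.im ≤ Y → -(M / (1 + l / (l + 1) * Y)) * ψ z ≤ w z := by
    intro Y hY him
    have hsub : Icc 0 l ×ℂ Icc 0 Y ⊆ Icc 0 l ×ℂ Ici 0 := fun ζ hζ => ⟨hζ.1, hζ.2.1⟩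
    have hsub' : Ioo 0 l ×ℂ Ioo 0 Y ⊆ Ioo 0 l ×ℂ Ioi 0 := fun ζ hζ => ⟨hζ.1, hζ.2.1⟩
    have hden : 0 < 1 + l / (l + 1) * Y := by positivity
    have hκ : 0 ≤ M / (1 + l / (l + 1) * Y) := div_nonneg hMnn hden.le
    refine neg_mul_le_of_rectangle hl hY hκ (hw.mono hsub') (hwc.mono hsub)
      (fun ζ hζ => hψharm ζ fun h => hp_mem (h ▸ hsub
        ⟨Ioo_subset_Icc_self hζ.1, Ioo_subset_Icc_self hζ.2⟩))
      ((Complex.continuous_im.continuousOn.add continuousOn_const).sub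
        (continuousOn_log_norm_sub fun h => hp_mem (hsub h))) (fun ζ hζ => hψpos ζ (hsub hζ))
      (fun y hy => ?_) (fun y hy => ?_) (fun x hx => ?_) (fun x hx hneg => ?_) z
      ⟨hz.1, hz.2, him⟩
    · have := mul_nonneg hκ (hψpos _ (hmem0 0 y ⟨le_rfl, hl.le⟩ hy.1)).le
      linarith [hleft y hy.1]
    · have := mul_nonneg hκ (hψpos _ (hmem0 l y ⟨hl.le, le_rfl⟩ hy.1)).le
      linarith [hright y hy.1]
    · have hm := hmem0 x Y hx hY.le
      have h2 : M ≤ M / (1 + l / (l + 1) * Y) * ψ ⟨x, Y⟩ := by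
        calc M = M / (1 + l / (l + 1) * Y) * (1 + l / (l + 1) * Y) :=
              (div_mul_cancel₀ _ hden.ne').symm
          _ ≤ _ := mul_le_mul_of_nonneg_left (hlow _ hm) hκ
      linarith [(abs_le.1 (hM _ hm)).1]
    · obtain ⟨hxε, d, hd, hdle⟩ := hbot x hx hneg
      have hm := hmem0 x 0 (Ioo_subset_Icc_self hx) le_rfl
      have hψd : HasDerivAt (fun y : ℝ => ψ ⟨x, y⟩)
          (1 - (0 - p.im) / ((x - p.re) ^ 2 + (0 - p.im) ^ 2)) 0 :=
        ((hasDerivAt_id (0 : ℝ)).add_const _).sub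
          (hasDerivAt_log_norm_sub fun h => hp_mem (h ▸ hm))
      refine ⟨d, _, hd, hψd.hasDerivWithinAt, ?_⟩
      have hup : ψ ⟨x, 0⟩ ≤ 1 + Real.log ((l + 1) / ε) := by
        rw [Real.log_div (by positivity) hε.ne']
        have := Real.log_le_log hε (hnorm _ hm)
        simp only [hψ]
        linarith
      have hslope : 1 / (2 * ε) ≤ (0 - p.im) / ((x - p.re) ^ 2 + (0 - p.im) ^ 2) := by
        simp only [hp]
        rw [zero_sub, neg_neg, div_le_div_iff₀ (by positivity) (by positivity)]
        nlinarith [mul_nonneg (by linarith : 0 ≤ ε - (l - x)) (by linarith [hx.2] : 0 ≤ ε + (l - x))]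
      have hψ0 := hψpos _ hm
      have h1 : d * ψ ⟨x, 0⟩ ≤ -L * w ⟨x, 0⟩ * (1 + Real.log ((l + 1) / ε)) := by
        refine (mul_le_mul_of_nonneg_right hdle hψ0.le).trans ?_
        exact mul_le_mul_of_nonneg_left hup (by nlinarith)
      nlinarith
  have hlim : Tendsto (fun Y : ℝ => -(M / (1 + l / (l + 1) * Y)) * ψ z) atTop
      (𝓝 (-0 * ψ z)) := by
    refine ((Tendsto.const_div_atTop ?_ M).neg).mul_const _
    exact tendsto_atTop_add_const_left _ 1 (tendsto_id.const_mul_atTop hμ)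
  rw [neg_zero, zero_mul] at hlim
  refine le_of_tendsto hlim ?_
  filter_upwards [eventually_gt_atTop 0, eventually_ge_atTop z.im] with Y h1 h2 using key Y h1 h2

/-! ### Barriers on rectangles -/

/-- A form of the Hopf lemma on the bottom of a rectangle. -/
lemma deriv_pos_of_rectangle {w : ℂ → ℝ} {l δ η x d : ℝ} (hδ : 0 < δ) (hη : 0 < η)
    (hx : x ∈ Ioo 0 l) (hw : HarmonicOnNhd w (Ioo 0 l ×ℂ Ioo 0 δ))
    (hwc : ContinuousOn w (Icc 0 l ×ℂ Icc 0 δ)) (hnn : ∀ z ∈ Icc 0 l ×ℂ Icc 0 δ, 0 ≤ w z)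
    (hleft : ∀ y ∈ Icc 0 δ, η ≤ w ⟨0, y⟩) (hx0 : w ⟨x, 0⟩ = 0)
    (hd : HasDerivWithinAt (fun y : ℝ => w ⟨x, y⟩) d (Ici 0) 0) : 0 < d := by
  have hl : 0 < l := hx.1.trans hx.2
  set k : ℝ := Real.pi / δ with hk
  have hk0 : 0 < k := div_pos Real.pi_pos hδ
  -- This barrier vanishes on the right, top and bottom sides and has positive `y`-derivative on the
  -- open bottom side.
  set b : ℂ → ℝ := fun z => Real.sinh (k * (l - z.re)) * Real.sin (k * z.im) with hb
  have hsinh : 0 < Real.sinh (k * l) := Real.sinh_pos_iff.2 (by positivity)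
  have hbharm : ∀ z, HarmonicAt b z := fun z => by
    have han : AnalyticAt ℂ (fun z : ℂ => -Complex.cosh (k * (l - z))) z := by
      have : Differentiable ℂ (fun z : ℂ => -Complex.cosh (k * (l - z))) := by fun_prop
      exact this.analyticAt z
    refine (harmonicAt_congr_nhds (Eventually.of_forall fun ζ => ?_)).1 han.harmonicAt_im
    have harg : (k * (l - ζ) : ℂ)
        = (k * (l - ζ.re) : ℝ) + (-(k * ζ.im) : ℝ) * Complex.I := by
      apply Complex.ext <;> simp
    simp only [hb]
    rw [harg, Complex.cosh_add, Complex.cosh_mul_I, Complex.sinh_mul_I, ← Complex.ofReal_cosh,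
      ← Complex.ofReal_sinh, ← Complex.ofReal_cos, ← Complex.ofReal_sin]
    simp only [Complex.neg_im, Complex.add_im, Complex.mul_im, Complex.mul_re, Complex.ofReal_re,
      Complex.ofReal_im, Complex.I_re, Complex.I_im, Real.sin_neg]
    ring
  have hbc : Continuous b := by
    simp only [hb]
    fun_prop
  set r := η / Real.sinh (k * l) with hr
  have hr0 : 0 < r := div_pos hη hsinh
  have hcomp := neg_mul_le_of_rectangle (w := w - r • b) (ψ := fun _ => 1) hl hδ le_rfl
    (hw.sub (HarmonicOnNhd.const_smul fun z _ => hbharm z))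
    (hwc.sub (hbc.continuousOn.const_smul r))
    (harmonicOnNhd_const 1) continuousOn_const (fun _ _ => one_pos) (fun y hy => ?_)
    (fun y hy => ?_) (fun x hx => ?_) (fun x hx hneg => ?_)
  · have hge : ∀ y ∈ Icc 0 δ, r * b ⟨x, y⟩ ≤ w ⟨x, y⟩ := fun y hy => by
      have := hcomp ⟨x, y⟩ ⟨Ioo_subset_Icc_self hx, hy⟩
      simp at this
      linarith
    have hbd : HasDerivAt (fun y : ℝ => b ⟨x, y⟩) (Real.sinh (k * (l - x)) * k) 0 := by
      have h1 : HasDerivAt (fun y : ℝ => Real.sin (k * y)) k 0 := by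
        simpa using ((hasDerivAt_id (0 : ℝ)).const_mul k).sin
      exact h1.const_mul (Real.sinh (k * (l - x)))
    have hnn := (hd.sub (hbd.hasDerivWithinAt.const_mul r)).nonneg_of_forall_le hδ (fun y hy => by
      have := hge y hy
      simp only [Pi.sub_apply]
      rw [hx0]
      simp only [hb, mul_zero, Real.sin_zero, sub_self]
      linarith)
    have : 0 < r * (Real.sinh (k * (l - x)) * k) :=
      mul_pos hr0 (mul_pos (Real.sinh_pos_iff.2 (mul_pos hk0 (sub_pos.2 hx.2))) hk0)
    linarith
  · have h1 : r * b ⟨0, y⟩ ≤ η := by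
      simp only [hb, sub_zero]
      rw [← mul_assoc, hr, div_mul_cancel₀ _ hsinh.ne']
      exact mul_le_of_le_one_right hη.le (Real.sin_le_one _)
    have := hleft y hy
    simp
    linarith
  · have := hnn ⟨l, y⟩ ⟨⟨hl.le, le_rfl⟩, hy⟩
    simpa [hb] using this
  · have := hnn ⟨x, δ⟩ ⟨hx, hδ.le, le_rfl⟩
    have hkδ : k * δ = Real.pi := div_mul_cancel₀ _ hδ.ne'
    simpa [hb, hkδ] using this
  · have := hnn ⟨x, 0⟩ ⟨Ioo_subset_Icc_self hx, le_rfl, hδ.le⟩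
    simp [hb] at hneg
    linarith

/-- A nonnegative harmonic function on a rectangle of size `2R × R` whose normal derivative on the
bottom is at least `c` has size at least `cR / 4`. -/
lemma le_of_rectangle_of_deriv_le {w : ℂ → ℝ} {a R c : ℝ} (hR : 0 < R) (hc : 0 < c)
    (hw : HarmonicOnNhd w (Ioo (a - R) (a + R) ×ℂ Ioo 0 R))
    (hwc : ContinuousOn w (Icc (a - R) (a + R) ×ℂ Icc 0 R))
    (hnn : ∀ z ∈ Icc (a - R) (a + R) ×ℂ Icc 0 R, 0 ≤ w z)
    (hbot : ∀ x ∈ Ioo (a - R) (a + R), ∃ d,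
      HasDerivWithinAt (fun y : ℝ => w ⟨x, y⟩) d (Ici 0) 0 ∧ d ≤ -c) :
    c * R / 4 ≤ w ⟨a, 0⟩ := by
  -- The barrier is nonpositive on the sides and top, has `y`-derivative `-1` on the bottom and
  -- equals `R / 2` at `a`. The factor `c / 2` below leaves a strict derivative inequality.
  set b : ℂ → ℝ := fun z => R / 2 - z.im - ((z.re - a) ^ 2 - z.im ^ 2) / (2 * R) with hb
  have hbharm : ∀ z, HarmonicAt b z := fun z => by
    have han : AnalyticAt ℂ
        (fun z : ℂ => (R / 2 : ℝ) + Complex.I * z - (1 / (2 * R) : ℝ) * (z - a) ^ 2) z := by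
      fun_prop
    refine (harmonicAt_congr_nhds (Eventually.of_forall fun ζ => ?_)).1 han.harmonicAt_re
    simp only [hb]
    rw [Complex.sub_re, Complex.re_ofReal_mul, pow_two (ζ - a)]
    simp only [Complex.add_re, Complex.ofReal_re, Complex.mul_re, Complex.I_re, Complex.I_im,
      Complex.sub_re, Complex.sub_im, Complex.ofReal_im]
    ring
  have hbc : Continuous b := by
    simp only [hb]
    fun_prop
  have hcomp := neg_mul_le_of_rectangle (w := w - (c / 2) • b) (ψ := fun _ => 1)
    (by linarith : a - R < a + R) hR le_rfl
    (hw.sub (HarmonicOnNhd.const_smul fun z _ => hbharm z))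
    (hwc.sub (hbc.continuousOn.const_smul _))
    (harmonicOnNhd_const 1) continuousOn_const (fun _ _ => one_pos) (fun y hy => ?_)
    (fun y hy => ?_) (fun x hx => ?_) (fun x hx hneg => ?_)
  · have := hcomp ⟨a, 0⟩ ⟨⟨by linarith, by linarith⟩, le_rfl, hR.le⟩
    simp [hb] at this
    linarith
  all_goals simp only [neg_zero, zero_mul, Pi.sub_apply, Pi.smul_apply, smul_eq_mul]
  · have h1 := hnn ⟨a - R, y⟩ ⟨⟨le_rfl, by linarith⟩, hy⟩
    have h2 : b ⟨a - R, y⟩ ≤ 0 := by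
      have : b ⟨a - R, y⟩ = y * (y - 2 * R) / (2 * R) := by
        simp only [hb]
        field_simp
        ring
      rw [this]
      exact div_nonpos_of_nonpos_of_nonneg
        (mul_nonpos_of_nonneg_of_nonpos hy.1 (by linarith [hy.2])) (by positivity)
    nlinarith
  · have h1 := hnn ⟨a + R, y⟩ ⟨⟨by linarith, le_rfl⟩, hy⟩
    have h2 : b ⟨a + R, y⟩ ≤ 0 := by
      have : b ⟨a + R, y⟩ = y * (y - 2 * R) / (2 * R) := by
        simp only [hb]
        field_simp
        ring
      rw [this]
      exact div_nonpos_of_nonpos_of_nonneg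
        (mul_nonpos_of_nonneg_of_nonpos hy.1 (by linarith [hy.2])) (by positivity)
    nlinarith
  · have h1 := hnn ⟨x, R⟩ ⟨hx, hR.le, le_rfl⟩
    have h2 : b ⟨x, R⟩ ≤ 0 := by
      have : b ⟨x, R⟩ = -((x - a) ^ 2 / (2 * R)) := by
        simp only [hb]
        field_simp
        ring
      rw [this]
      exact neg_nonpos.2 (by positivity)
    nlinarith
  · obtain ⟨d, hd, hdc⟩ := hbot x hx
    have hbd : HasDerivAt (fun y : ℝ => b ⟨x, y⟩) (-1) 0 := by
      have h1 : HasDerivAt (fun y : ℝ => R / 2 - y - ((x - a) ^ 2 - y ^ 2) / (2 * R))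
          (-1 - (-(2 * 0)) / (2 * R)) 0 := by
        have h2 : HasDerivAt (fun y : ℝ => (x - a) ^ 2 - y ^ 2) (-(2 * 0)) 0 := by
          simpa using ((hasDerivAt_id (0 : ℝ)).pow 2).const_sub ((x - a) ^ 2)
        exact ((hasDerivAt_id (0 : ℝ)).const_sub (R / 2)).sub (h2.div_const (2 * R))
      simpa using h1
    refine ⟨d - c / 2 * -1, 0, hd.sub (hbd.hasDerivWithinAt.const_mul (c / 2)),
      hasDerivWithinAt_const _ _ _, ?_⟩
    linarith

/-! ### Moving planes -/

/-- Supplies the width `ε` for `nonneg_of_halfStrip`: with `t = 1 / ε`, `log t` is negligible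
against `t`. -/
lemma exists_log_lt_one_div {L A : ℝ} (hL : 0 ≤ L) (hA : 0 < A) :
    ∃ ε : ℝ, 0 < ε ∧ ε ≤ 1 ∧ L * (1 + Real.log (A / ε)) + 1 < 1 / (2 * ε) := by
  have hc : 0 < 1 / (4 * (L + 1)) := by positivity
  obtain ⟨t, hlog, ht, ht1⟩ := ((Real.isLittleO_log_id_atTop.bound hc).and
    ((eventually_gt_atTop (4 * (L * (1 + Real.log A) + 1))).and (eventually_ge_atTop 1))).exists
  have ht0 : 0 < t := by linarith
  refine ⟨1 / t, by positivity, by rw [div_le_one ht0]; exact ht1, ?_⟩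
  have h1 : L * Real.log t ≤ t / 4 := by
    have h2 : Real.log t ≤ 1 / (4 * (L + 1)) * t := by
      have := (le_abs_self _).trans hlog
      simpa [abs_of_pos ht0] using this
    calc L * Real.log t ≤ L * (1 / (4 * (L + 1)) * t) := mul_le_mul_of_nonneg_left h2 hL
      _ = L / (L + 1) * (t / 4) := by field_simp
      _ ≤ 1 * (t / 4) := by
        refine mul_le_mul_of_nonneg_right ?_ (by positivity)
        rw [div_le_one (by positivity)]
        linarith
      _ = t / 4 := one_mul _
  have h3 : A / (1 / t) = A * t := by field_simp
  have h4 : 1 / (2 * (1 / t)) = t / 2 := by field_simp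
  rw [h3, h4, Real.log_mul hA.ne' ht0.ne']
  nlinarith

/-- The difference between the reflection of `v` in the line `re z = l` and `v`. -/
def reflectionDiff (v : ℂ → ℝ) (l : ℝ) (z : ℂ) : ℝ :=
  v ((2 * l : ℝ) - (starRingEnd ℂ) z) - v z

lemma reflectionDiff_mk (v : ℂ → ℝ) (l x y : ℝ) :
    reflectionDiff v l ⟨x, y⟩ = v ⟨2 * l - x, y⟩ - v ⟨x, y⟩ := by
  have : ((2 * l : ℝ) - (starRingEnd ℂ) ⟨x, y⟩ : ℂ) = ⟨2 * l - x, y⟩ := by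
    apply Complex.ext <;> simp
  rw [reflectionDiff, this]

lemma harmonicOnNhd_reflectionDiff {v : ℂ → ℝ} {l : ℝ} (hv : HarmonicOnNhd v quarterPlane) :
    HarmonicOnNhd (reflectionDiff v l) (Ioo 0 l ×ℂ Ioi 0) := by
  intro z hz
  have hx : z.re ∈ Ioo 0 l := hz.1
  have hy : 0 < z.im := hz.2
  refine (HarmonicAt.comp_reflection (2 * l) (hv _ ⟨?_, ?_⟩)).sub (hv z ⟨hx.1, hy⟩)
  · simp
    linarith [hx.1, hx.2]
  · simpa using hy

lemma continuousOn_reflectionDiff {v : ℂ → ℝ} {l : ℝ} (hv : ContinuousOn v closedQuarterPlane) :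
    ContinuousOn (reflectionDiff v l) (Icc 0 l ×ℂ Ici 0) := by
  refine ContinuousOn.sub (hv.comp ?_ fun z hz => ⟨?_, ?_⟩) (hv.mono fun z hz => ⟨hz.1.1, hz.2⟩)
  · exact (continuous_const.sub Complex.continuous_conj).continuousOn
  · have hx : z.re ∈ Icc 0 l := hz.1
    simp
    linarith [hx.1, hx.2]
  · have hy : 0 ≤ z.im := hz.2
    simpa using hy

/-- The method of moving planes: if the normal derivative of the extension is `-f ∘ u`, with `f`
one-sided Lipschitz on the range of `u`, then `u` does not exceed its reflections. -/
lemma IsDirichletHarmonicExtension.le_reflection {u f : ℝ → ℝ} {v : ℂ → ℝ} {L : ℝ}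
    (hv : IsDirichletHarmonicExtension u v) (hvnn : ∀ z ∈ closedQuarterPlane, 0 ≤ v z)
    (hd : ∀ x : ℝ, 0 < x → HasDerivWithinAt (fun y : ℝ => v ⟨x, y⟩) (-(f (u x))) (Ici 0) 0)
    (hL : 0 ≤ L)
    (hf : ∀ x y : ℝ, 0 ≤ x → 0 ≤ y → u y ≤ u x → f (u x) - f (u y) ≤ L * (u x - u y))
    (hu : ContinuousOn u (Ici 0)) (hpos : ∀ x : ℝ, 0 < x → 0 < u x) (hu0 : u 0 = 0)
    {l x : ℝ} (hx : x ∈ Icc 0 l) : u x ≤ u (2 * l - x) := by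
  rcases (hx.1.trans hx.2).eq_or_lt with rfl | hl
  · have : x = 0 := le_antisymm hx.2 hx.1
    simp [this]
  obtain ⟨M, hM⟩ := hv.bounded
  have hmem : ∀ x y : ℝ, 0 ≤ x → 0 ≤ y → (⟨x, y⟩ : ℂ) ∈ closedQuarterPlane :=
    fun x y hx hy => ⟨hx, hy⟩
  obtain ⟨ε, hε, hε1, hsmall⟩ := exists_log_lt_one_div hL (by linarith : 0 < l + 1)
  have htrace : ∀ m x : ℝ, x ∈ Icc 0 m →
      reflectionDiff v m ⟨x, 0⟩ = u (2 * m - x) - u x := fun m x hx => by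
    rw [reflectionDiff_mk, hv.trace _ (by linarith [hx.1, hx.2]), hv.trace _ hx.1]
  have hderiv : ∀ m x : ℝ, x ∈ Ioo 0 m →
      HasDerivWithinAt (fun y : ℝ => reflectionDiff v m ⟨x, y⟩)
        (f (u x) - f (u (2 * m - x))) (Ici 0) 0 := fun m x hx => by
    simp only [reflectionDiff_mk]
    exact ((hd (2 * m - x) (by linarith [hx.1, hx.2])).sub (hd x hx.1)).congr_deriv (by ring)
  have hleft : ∀ m y : ℝ, 0 ≤ y → reflectionDiff v m ⟨0, y⟩ = v ⟨2 * m, y⟩ := fun m y hy => by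
    rw [reflectionDiff_mk, hv.lateral y hy, sub_zero, sub_zero]
  -- The same `ε` serves every `m ≤ l`, so only points at distance at least `ε` from the mirror need
  -- checking.
  have hstrip : ∀ m, 0 < m → m ≤ l →
      (∀ x ∈ Ioo 0 m, x ≤ m - ε → u x ≤ u (2 * m - x)) →
      ∀ z ∈ Icc 0 m ×ℂ Ici 0, 0 ≤ reflectionDiff v m z := by
    intro m hm hml hfar
    have hsmall' : L * (1 + Real.log ((m + 1) / ε)) + 1 < 1 / (2 * ε) := by
      refine lt_of_le_of_lt ?_ hsmall
      gcongr
    refine nonneg_of_halfStrip (M := M + M) hm hε hε1 hL hsmall'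
      (harmonicOnNhd_reflectionDiff hv.harmonic) (continuousOn_reflectionDiff hv.continuousOn)
      (fun z hz => ?_) (fun y hy => ?_) (fun y hy => ?_) (fun x hx hneg => ?_)
    · obtain ⟨x, y⟩ := z
      have hx : x ∈ Icc 0 m := hz.1
      rw [reflectionDiff_mk]
      exact (abs_sub _ _).trans
        (add_le_add (hM _ (hmem _ _ (by linarith [hx.1, hx.2]) hz.2)) (hM _ (hmem _ _ hx.1 hz.2)))
    · rw [hleft m y hy]
      exact hvnn _ (hmem _ _ (by linarith) hy)
    · rw [reflectionDiff_mk, two_mul, add_sub_cancel_right, sub_self]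
    · rw [htrace m x (Ioo_subset_Icc_self hx)] at hneg ⊢
      refine ⟨?_, _, hderiv m x hx, ?_⟩
      · by_contra! hle
        linarith [hfar x hx hle]
      · linarith [hf x (2 * m - x) hx.1.le (by linarith [hx.1, hx.2]) (by linarith)]
  by_contra! hlt
  set S : Set ℝ := {m | 0 < m ∧ m ≤ l ∧ ∃ x ∈ Icc 0 m, u (2 * m - x) < u x} with hS
  have hSne : S.Nonempty := ⟨l, hl, le_rfl, x, hx, hlt⟩
  -- Violations therefore stay away from the mirror; this starts the procedure, since no `m < ε` is
  -- bad.
  have hSfar : ∀ m ∈ S, ∃ x, 0 < x ∧ x ≤ m - ε ∧ u (2 * m - x) < u x := by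
    rintro m ⟨hm, hml, x, hx, hlt⟩
    by_contra! hcon
    have := hstrip m hm hml (fun x hx hxε => hcon x hx.1 hxε) ⟨x, 0⟩ ⟨hx, le_refl (0 : ℝ)⟩
    rw [htrace m x hx] at this
    linarith
  have hSε : ∀ m ∈ S, ε ≤ m := fun m hm => by
    obtain ⟨x, hx0, hxε, -⟩ := hSfar m hm
    linarith
  have hSbdd : BddBelow S := ⟨ε, hSε⟩
  set m := sInf S with hm_def
  have hmε : ε ≤ m := le_csInf hSne hSε
  have hm0 : 0 < m := hε.trans_le hmε
  have hml : m ≤ l := csInf_le hSbdd ⟨hl, le_rfl, x, hx, hlt⟩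
  have hcont : ∀ t, 0 < t → ContinuousAt u t := fun t ht => hu.continuousAt (Ici_mem_nhds ht)
  -- A strict violation at `m` would persist for slightly smaller planes, against the infimum.
  have hmle : ∀ x ∈ Icc 0 m, u x ≤ u (2 * m - x) := by
    intro x hx
    rcases hx.2.eq_or_lt with rfl | hxm
    · rw [two_mul, add_sub_cancel_right]
    by_contra! hlt
    have hc : ContinuousAt (fun t => u (2 * t - x)) m :=
      ContinuousAt.comp (f := fun t => 2 * t - x) (hcont _ (by linarith [hx.1])) (by fun_prop)
    have hev : ∀ᶠ t in 𝓝[<] m, u (2 * t - x) < u x :=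
      (hc.eventually_lt continuousAt_const hlt).filter_mono nhdsWithin_le_nhds
    obtain ⟨t, ht, htx, htm⟩ := (hev.and (Ioo_mem_nhdsLT hxm)).exists
    exact htm.not_ge (csInf_le hSbdd
      ⟨hx.1.trans_lt htx, htm.le.trans hml, x, ⟨hx.1, htx.le⟩, ht⟩)
  have hmnn := hstrip m hm0 hml fun x hx _ => hmle x (Ioo_subset_Icc_self hx)
  obtain ⟨s, -, hslim, hsmem⟩ := exists_seq_tendsto_sInf hSne hSbdd
  choose! X hX0 hXε hXlt using hSfar
  -- Violating points for planes tending to `m` accumulate at a contact point `x₀ ≤ m - ε`.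
  obtain ⟨x₀, hx₀, φ, hφ, hXlim⟩ := isCompact_Icc.tendsto_subseq (s := Icc 0 l)
    (x := fun n => X (s n)) fun n =>
      ⟨(hX0 _ (hsmem n)).le, by linarith [hXε _ (hsmem n), (hsmem n).2.1]⟩
  have hslim' : Tendsto (fun n => s (φ n)) atTop (𝓝 m) := hslim.comp hφ.tendsto_atTop
  have hx₀ε : x₀ ≤ m - ε := le_of_tendsto_of_tendsto' hXlim (hslim'.sub_const ε)
    fun n => hXε _ (hsmem _)
  have hx₀le : u (2 * m - x₀) ≤ u x₀ := by
    have h1 : Tendsto (fun n => u (2 * s (φ n) - X (s (φ n)))) atTop (𝓝 (u (2 * m - x₀))) :=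
      (hcont _ (by linarith [hx₀.1])).tendsto.comp ((hslim'.const_mul 2).sub hXlim)
    have h2 : Tendsto (fun n => u (X (s (φ n)))) atTop (𝓝 (u x₀)) :=
      (hu x₀ hx₀.1).tendsto.comp (tendsto_nhdsWithin_iff.2
        ⟨hXlim, Eventually.of_forall fun n => (hX0 _ (hsmem _)).le⟩)
    exact le_of_tendsto_of_tendsto' h1 h2 fun n => (hXlt _ (hsmem _)).le
  have hx₀pos : 0 < x₀ := by
    rcases hx₀.1.eq_or_lt with rfl | h
    · rw [hu0, sub_zero] at hx₀le
      exact absurd (hpos (2 * m) (by linarith)) hx₀le.not_gt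
    · exact h
  have hx₀m : x₀ ∈ Ioo 0 m := ⟨hx₀pos, by linarith⟩
  have hueq : u (2 * m - x₀) = u x₀ := le_antisymm hx₀le (hmle x₀ (Ioo_subset_Icc_self hx₀m))
  have hu2m : 0 < u (2 * m) := hpos _ (by linarith)
  obtain ⟨δ, hδ, hδsub⟩ : ∃ δ : ℝ, 0 < δ ∧ ∀ y ∈ Icc 0 δ, u (2 * m) / 2 ≤ v ⟨2 * m, y⟩ := by
    have hc : ContinuousWithinAt (fun y : ℝ => v ⟨2 * m, y⟩) (Ici 0) 0 :=
      (hd (2 * m) (by linarith)).continuousWithinAt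
    have hev : ∀ᶠ y in 𝓝[≥] (0 : ℝ), u (2 * m) / 2 < v ⟨2 * m, y⟩ := by
      refine hc.tendsto.eventually_const_lt ?_
      rw [hv.trace _ (by linarith)]
      linarith
    obtain ⟨δ, hδ, hsub⟩ := mem_nhdsGE_iff_exists_Icc_subset.1 hev
    exact ⟨δ, hδ, fun y hy => (hsub hy).le⟩
  have hlast := deriv_pos_of_rectangle (w := reflectionDiff v m) hδ (half_pos hu2m) hx₀m
    ((harmonicOnNhd_reflectionDiff hv.harmonic).mono fun z hz => ⟨hz.1, hz.2.1⟩)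
    ((continuousOn_reflectionDiff hv.continuousOn).mono fun z hz => ⟨hz.1, hz.2.1⟩)
    (fun z hz => hmnn z ⟨hz.1, hz.2.1⟩)
    (fun y hy => by rw [hleft m y hy.1]; exact hδsub y hy)
    (by rw [htrace m x₀ (Ioo_subset_Icc_self hx₀m), hueq, sub_self]) (hderiv m x₀ hx₀m)
  -- At the contact point the two values of `f ∘ u` cancel, so the Hopf derivative is zero.
  rw [hueq, sub_self] at hlast
  exact lt_irrefl 0 hlast

end

/-! ### Conclusion -/

theorem corollary4p3 (f : ℝ → ℝ) (hf : ContDiffOn ℝ 1 f (Ici 0)) (hmono : MonotoneOn f (Ici 0))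
    (hf0 : f 0 = 0) :
    ¬ ∃ u : ℝ → ℝ,
      ContinuousOn u (Ici 0) ∧
      (∃ C : ℝ, ∀ x : ℝ, 0 ≤ x → |u x| ≤ C) ∧
      HasDirichletSqrtLaplacian u (fun x => f (u x)) ∧
      (∀ x : ℝ, 0 < x → 0 < u x) ∧
      u 0 = 0 := by
  rintro ⟨u, hu, ⟨C, hC⟩, ⟨v, hv, hd⟩, hpos, hu0⟩
  obtain ⟨M, hM⟩ := hv.bounded
  have hunn : ∀ x : ℝ, 0 ≤ x → 0 ≤ u x := fun x hx => by
    rcases hx.eq_or_lt with rfl | h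
    · exact hu0.ge
    · exact (hpos x h).le
  have hvnn : ∀ z ∈ closedQuarterPlane, 0 ≤ v z :=
    nonneg_of_quarterPlane hv.harmonic hv.continuousOn hM (fun y hy => (hv.lateral y hy).ge)
      fun x hx hneg => absurd (hunn x hx.le) (by rw [← hv.trace x hx.le]; exact hneg.not_ge)
  obtain ⟨K, hK⟩ := (hf.mono fun x (hx : x ∈ Icc 0 C) => hx.1).exists_lipschitzOnWith one_ne_zero
    (convex_Icc 0 C) isCompact_Icc
  have humem : ∀ x : ℝ, 0 ≤ x → u x ∈ Icc 0 C := fun x hx =>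
    ⟨hunn x hx, (le_abs_self _).trans (hC x hx)⟩
  -- Reflection in the midpoint of `x` and `y` exchanges them.
  have humono : ∀ x y : ℝ, 0 ≤ x → x ≤ y → u x ≤ u y := fun x y hx hxy => by
    have := hv.le_reflection (f := f) (L := K) hvnn hd K.2 (fun x y hx hy hle => by
      have := hK.dist_le_mul _ (humem x hx) _ (humem y hy)
      rw [Real.dist_eq, Real.dist_eq, abs_of_nonneg (sub_nonneg.2 hle)] at this
      exact (le_abs_self _).trans this) hu hpos hu0 (l := (x + y) / 2) (x := x)
      ⟨hx, by linarith⟩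
    rwa [show 2 * ((x + y) / 2) - x = y by ring] at this
  have hfu : ∀ a : ℝ, 0 < a → f (u a) = 0 := by
    intro a ha
    refine le_antisymm ?_ (hf0 ▸ hmono self_mem_Ici (hunn a ha.le) (hunn a ha.le))
    by_contra! hfa
    -- The rectangle is centred at `a + R`, so its base `[a, a + 2R]` lies where the flux is at
    -- least `f (u a)`.
    have hbound : ∀ R : ℝ, 0 < R → f (u a) * R / 4 ≤ C := by
      intro R hR
      refine le_trans ?_ (humem (a + R) (by linarith)).2
      rw [← hv.trace (a + R) (by linarith)]
      refine le_of_rectangle_of_deriv_le hR hfa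
        (hv.harmonic.mono fun z hz => ⟨by linarith [hz.1.1], hz.2.1⟩)
        (hv.continuousOn.mono fun z hz => ⟨by linarith [hz.1.1], hz.2.1⟩)
        (fun z hz => hvnn z ⟨by linarith [hz.1.1], hz.2.1⟩) (fun x hx => ?_)
      have hax : a ≤ x := by linarith [hx.1]
      exact ⟨_, hd x (ha.trans_le hax), neg_le_neg (hmono (hunn a ha.le)
        (hunn x (ha.le.trans hax)) (humono a x ha.le hax))⟩
    have hCnn : 0 ≤ C := (abs_nonneg _).trans (hC 0 le_rfl)
    have := hbound (4 * (C + 1) / f (u a)) (by positivity)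
    have heq : f (u a) * (4 * (C + 1) / f (u a)) / 4 = C + 1 := by field_simp
    linarith
  have hvneg : ∀ z ∈ closedQuarterPlane, 0 ≤ (-v) z :=
    nonneg_of_quarterPlane hv.harmonic.neg hv.continuousOn.neg
      (M := M) (fun z hz => by rw [Pi.neg_apply, abs_neg]; exact hM z hz)
      (fun y hy => by rw [Pi.neg_apply, hv.lateral y hy, neg_zero])
      fun x hx _ => (hd x hx).neg.congr_deriv (by simp [hfu x hx])
  have h1 := hvneg ⟨1, 0⟩ ⟨zero_le_one, le_rfl⟩
  rw [Pi.neg_apply, hv.trace 1 zero_le_one] at h1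
  linarith [hpos 1 one_pos]
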